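/- An $n\times n$ real matrix $C=[c_{ij}]$ is centrosymmetric if $c_{i,j}=c_{n-i+1,n-j+1}$ for all $i,j$, and nonnegative if all its entries are nonnegative. The spectrum of an $n\times n$ matrix is the list of its $n$ complex eigenvalues, counted with algebraic multiplicity. Let $\Lambda=\{\lambda_1,\lambda_2,\lambda_3,\ldots,\lambda_n\}$, $n\ge 2$, be the spectrum of an $n\times n$ nonnegative centrosymmetric matrix, where $\lambda_1=\max_{1\le i\le n}|\lambda_i|$ is its Perron eigenvalue, and suppose that $\lambda_2$ is a real number. Then for every real $t\ge 0$ both lists $$\Lambda_t^{+}=\{\lambda_1+t,\ \lambda_2+t,\ \lambda_3,\ldots,\lambda_n\}\quad\text{and}\quad \Lambda_t^{-}=\{\lambda_1+t,\ \lambda_2-t,\ \lambda_3,\ldots,\lambda_n\}$$ are spectra of $n\times n$ nonnegative centrosymmetric matrices, with Perron eigenvalue $\lambda_1+t$ (that is, $\lambda_1+t$ is the maximum of the moduli of the elements of each list). -/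

import Mathlib

/-- The spectrum of a real `n × n` matrix: the list of its `n` complex eigenvalues,
counted with algebraic multiplicity. -/
noncomputable def spectrumList {n : ℕ} (C : Matrix (Fin n) (Fin n) ℝ) : Multiset ℂ :=
  (C.map (algebraMap ℝ ℂ)).charpoly.roots

/-- `C` is (entrywise) nonnegative. -/
def IsNonnegative {n : ℕ} (C : Matrix (Fin n) (Fin n) ℝ) : Prop :=
  ∀ i j, 0 ≤ C i j

/-- `C` is centrosymmetric: `c_{i,j} = c_{n-i+1,n-j+1}` in 1-based indexing. -/
def IsCentrosymmetric {n : ℕ} (C : Matrix (Fin n) (Fin n) ℝ) : Prop :=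
  ∀ i j, C i j = C i.rev j.rev

/-- The collection of all lists of `n` complex numbers that are the spectrum of an
`n × n` nonnegative centrosymmetric matrix. -/
def CR (n : ℕ) : Set (Multiset ℂ) :=
  {L | ∃ C : Matrix (Fin n) (Fin n) ℝ,
    IsNonnegative C ∧ IsCentrosymmetric C ∧ spectrumList C = L}

/-- The real number `r` is the Perron eigenvalue of the list `L`: it belongs to `L` and
`r = max {|μ| : μ ∈ L}`. -/
def IsPerronEigenvalue (r : ℝ) (L : Multiset ℂ) : Prop :=
  (r : ℂ) ∈ L ∧ ∀ μ ∈ L, ‖μ‖ ≤ r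

/-! Suppose `C` has all row sums `λ₁`, and `v` is nonconstant with `C v = λ₂ v + c 1`. By Brauer's
theorem, adding `1 aᵀ + v bᵀ` with `∑ b = 0` alters only `λ₁` and `λ₂`, by `∑ a` and `b · v`. Mass
on the columns where `v` is maximal and minimal makes the perturbation nonnegative with `∑ a = t`
and `b · v = t`; swapping the two columns gives `-t`. If `v` is even or odd under index reversal,
averaging with the reversed perturbation restores centrosymmetry at no cost.

The remaining work is to reach constant row sums within the cospectral class: a reversal-invariant
diagonal scaling and a compactness argument give row sums at most `λ₁`, then
`exists_cospectral_rowSum_eq` fills the deficient rows. -/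

/-! ### Brauer's theorem and spectra -/

open Matrix in
/-- Brauer's theorem: if the columns of `X` span an invariant subspace of `C`, on which `C` acts
as `Ω`, then adding `X * W` to `C` replaces the eigenvalues of `Ω` by those of `Ω + W * X`. -/
theorem charpoly_add_mul_of_mul_eq_mul {R m k : Type*} [CommRing R] [Fintype m] [DecidableEq m]
    [Fintype k] [DecidableEq k] {C : Matrix m m R} {X : Matrix m k R} {Ω : Matrix k k R}
    (h : C * X = X * Ω) (W : Matrix k m R) :
    (C + X * W).charpoly * Ω.charpoly = C.charpoly * (Ω + W * X).charpoly := by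
  -- Each side is the characteristic polynomial of a block triangular matrix; a unipotent matrix
  -- built from `X` conjugates one into the other.
  rw [← charpoly_fromBlocks_zero₁₂ (C + X * W) W Ω,
    ← charpoly_fromBlocks_zero₁₂ C W (Ω + W * X)]
  have hconj : fromBlocks C 0 W (Ω + W * X) =
      fromBlocks 1 (-X) 0 1 * (fromBlocks (C + X * W) 0 W Ω * fromBlocks 1 X 0 1) := by
    simp [fromBlocks_multiply, Matrix.mul_add, Matrix.add_mul, Matrix.mul_assoc, h, add_comm]
    abel
  rw [hconj, charpoly_mul_comm, Matrix.mul_assoc]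
  simp [fromBlocks_multiply]

theorem spectrumList_eq_of_charpoly_eq {n : ℕ} {C D : Matrix (Fin n) (Fin n) ℝ}
    (h : C.charpoly = D.charpoly) : spectrumList C = spectrumList D := by
  rw [spectrumList, spectrumList, Matrix.charpoly_map, Matrix.charpoly_map, h]

theorem spectrumList_add_mul_of_mul_eq_mul {n k : ℕ} {C : Matrix (Fin n) (Fin n) ℝ}
    {X : Matrix (Fin n) (Fin k) ℝ} {Ω : Matrix (Fin k) (Fin k) ℝ}
    (h : C * X = X * Ω) (W : Matrix (Fin k) (Fin n) ℝ) :
    spectrumList (C + X * W) + spectrumList Ω = spectrumList C + spectrumList (Ω + W * X) := by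
  have key := congrArg (Polynomial.map (algebraMap ℝ ℂ)) (charpoly_add_mul_of_mul_eq_mul h W)
  simp only [Polynomial.map_mul, ← Matrix.charpoly_map] at key
  simp only [spectrumList]
  rw [← Polynomial.roots_mul, ← Polynomial.roots_mul, key]
  all_goals exact mul_ne_zero (Matrix.charpoly_monic _).ne_zero (Matrix.charpoly_monic _).ne_zero

theorem spectrumList_of_isUpperTriangular {n : ℕ} {C : Matrix (Fin n) (Fin n) ℝ}
    (h : C.IsUpperTriangular) :
    spectrumList C = Finset.univ.val.map fun i => ((C i i : ℝ) : ℂ) := by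
  rw [spectrumList, Matrix.charpoly_map, Matrix.charpoly_of_isUpperTriangular C h,
    Polynomial.map_prod, Polynomial.roots_prod]
  · simp [Multiset.bind_singleton]
  · exact Finset.prod_ne_zero_iff.2 fun i _ => by simpa using Polynomial.X_sub_C_ne_zero _

theorem exists_mulVec_eq_smul_of_mem_spectrumList {n : ℕ} {C : Matrix (Fin n) (Fin n) ℝ} {r : ℝ}
    (h : (r : ℂ) ∈ spectrumList C) : ∃ v ≠ 0, C.mulVec v = r • v := by
  have hroot : C.charpoly.IsRoot r := by
    have h' := Polynomial.isRoot_of_mem_roots h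
    rw [Matrix.charpoly_map] at h'
    exact Polynomial.IsRoot.of_map (f := algebraMap ℝ ℂ) h' (algebraMap ℝ ℂ).injective
  rw [Polynomial.IsRoot, Matrix.eval_charpoly, ← Matrix.exists_mulVec_eq_zero_iff] at hroot
  obtain ⟨v, hv, h0⟩ := hroot
  refine ⟨v, hv, ?_⟩
  rw [Matrix.sub_mulVec, sub_eq_zero] at h0
  rw [← h0]
  ext i
  simp [Matrix.scalar_apply, Matrix.mulVec_diagonal]

theorem IsCentrosymmetric.mulVec_comp_rev {n : ℕ} {C : Matrix (Fin n) (Fin n) ℝ}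
    (hC : IsCentrosymmetric C) (v : Fin n → ℝ) (i : Fin n) :
    C.mulVec (fun j => v j.rev) i = C.mulVec v i.rev := by
  simp only [Matrix.mulVec, dotProduct]
  rw [← Equiv.sum_comp Fin.revPerm]
  refine Finset.sum_congr rfl fun j _ => ?_
  rw [hC]
  simp

theorem continuous_eval_charpoly {n : ℕ} (t : ℝ) :
    Continuous fun C : Matrix (Fin n) (Fin n) ℝ => C.charpoly.eval t := by
  simp only [Matrix.eval_charpoly]
  fun_prop

/-! ### Row sums at most the Perron eigenvalue -/

-- Gelfand's formula for the maximal row sum norm.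
open Matrix in
theorem exists_pow_linfty_opNorm_le {n : ℕ} (A : Matrix (Fin n) (Fin n) ℂ) {r s : ℝ}
    (hr : 0 ≤ r) (hrs : r < s) (h : ∀ μ ∈ spectrum ℂ A, ‖μ‖ ≤ r) :
    ∃ N, 0 < N ∧ ∀ i, ∑ j, ‖(A ^ N) i j‖ ≤ s ^ N := by
  let := Matrix.linftyOpNormedRing (n := Fin n) (α := ℂ)
  let := Matrix.linftyOpNormedAlgebra (R := ℂ) (n := Fin n) (α := ℂ)
  have hsp : spectralRadius ℂ A < ENNReal.ofReal s := by
    refine lt_of_le_of_lt (b := ENNReal.ofReal r) ?_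
      ((ENNReal.ofReal_lt_ofReal_iff (hr.trans_lt hrs)).2 hrs)
    refine iSup₂_le fun μ hμ => ?_
    rw [← enorm_eq_nnnorm, ← ofReal_norm]
    exact ENNReal.ofReal_le_ofReal (h μ hμ)
  have hev := (spectrum.pow_norm_pow_one_div_tendsto_nhds_spectralRadius A).eventually_lt_const hsp
  obtain ⟨N, hN, hpos⟩ := (hev.and (Filter.eventually_gt_atTop 0)).exists
  refine ⟨N, hpos, fun i => ?_⟩
  have hs : 0 < s := hr.trans_lt hrs
  rw [ENNReal.ofReal_lt_ofReal_iff hs] at hN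
  have hle : ‖A ^ N‖ ≤ s ^ N := by
    have := pow_le_pow_left₀ (Real.rpow_nonneg (norm_nonneg _) _) hN.le N
    rwa [one_div, Real.rpow_inv_natCast_pow (norm_nonneg _) hpos.ne'] at this
  refine le_trans ?_ hle
  have h1 : (∑ j, ‖(A ^ N) i j‖₊) ≤ ‖A ^ N‖₊ := by
    rw [Matrix.linfty_opNNNorm_def]
    exact Finset.le_sup (f := fun i => ∑ j, ‖(A ^ N) i j‖₊) (Finset.mem_univ i)
  simpa using NNReal.coe_le_coe.2 h1

/-- A truncated Neumann series `y = ∑_{k<N} s^(N-1-k) C^k 1` telescopes: `s y - C y = s^N 1 - C^N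
1`, nonnegative for the `N` from Gelfand's formula. -/
theorem IsNonnegative.exists_pos_mulVec_le {n : ℕ} {C : Matrix (Fin n) (Fin n) ℝ}
    (hC : IsNonnegative C) {r s : ℝ} (hr : 0 ≤ r) (hrs : r < s)
    (h : ∀ μ ∈ spectrumList C, ‖μ‖ ≤ r) :
    ∃ y : Fin n → ℝ, (∀ i, 0 < y i) ∧ ∀ i, C.mulVec y i ≤ s * y i := by
  have hs : 0 < s := hr.trans_lt hrs
  obtain ⟨N, hN, hb⟩ := exists_pow_linfty_opNorm_le (C.map (algebraMap ℝ ℂ)) hr hrs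
    fun μ hμ => h μ ((Polynomial.mem_roots (Matrix.charpoly_monic _).ne_zero).2
      (Matrix.mem_spectrum_iff_isRoot_charpoly.1 hμ))
  have hnn : ∀ k i, 0 ≤ (C ^ k).mulVec 1 i := by
    intro k
    induction k with
    | zero => simp
    | succ k ih =>
      intro i
      rw [pow_succ', ← Matrix.mulVec_mulVec]
      rw [Matrix.mulVec_apply_eq_sum]
      exact Finset.sum_nonneg fun j _ => mul_nonneg (hC i j) (ih j)
  have hbN : ∀ i, (C ^ N).mulVec 1 i ≤ s ^ N := by
    intro i
    refine le_trans ?_ (hb i)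
    rw [← Matrix.map_pow]
    simp only [Matrix.mulVec, dotProduct, Pi.one_apply, mul_one, Matrix.map_apply]
    refine Finset.sum_le_sum fun j _ => ?_
    simpa using le_abs_self _
  obtain ⟨M, rfl⟩ : ∃ M, N = M + 1 := ⟨N - 1, by omega⟩
  have hmv : ∀ i, C.mulVec (fun i => ∑ k ∈ Finset.range (M + 1), s ^ (M - k) * (C ^ k).mulVec 1 i) i
      = ∑ k ∈ Finset.range (M + 1), s ^ (M - k) * (C ^ (k + 1)).mulVec 1 i := by
    intro i
    simp only [pow_succ', ← Matrix.mulVec_mulVec]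
    simp only [Matrix.mulVec, dotProduct, Finset.mul_sum]
    rw [Finset.sum_comm]
    refine Finset.sum_congr rfl fun k _ => Finset.sum_congr rfl fun j _ => Finset.sum_congr rfl ?_
    intros
    ring
  refine ⟨fun i => ∑ k ∈ Finset.range (M + 1), s ^ (M - k) * (C ^ k).mulVec 1 i, fun i => ?_,
    fun i => ?_⟩
  · refine Finset.sum_pos' (fun k _ => mul_nonneg (pow_nonneg hs.le _) (hnn k i))
      ⟨0, by simp, ?_⟩
    simpa using pow_pos hs M
  · beta_reduce
    rw [hmv, Finset.sum_range_succ, Finset.sum_range_succ' _ M, mul_add, Finset.mul_sum]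
    refine add_le_add (Finset.sum_le_sum fun k hk => ?_) ?_
    · rw [← mul_assoc, ← pow_succ']
      have : M - (k + 1) + 1 = M - k := by have := Finset.mem_range.1 hk; omega
      rw [this]
    · simpa [pow_succ'] using hbN i

/-- Conjugation by the diagonal of `y` bounds the row sums; `y` is first symmetrized so that
centrosymmetry survives. -/
theorem exists_cospectral_rowSum_le_of_lt {n : ℕ} {C : Matrix (Fin n) (Fin n) ℝ}
    (hC : IsNonnegative C) (hsymm : IsCentrosymmetric C) {r s : ℝ} (hr : 0 ≤ r) (hrs : r < s)
    (h : ∀ μ ∈ spectrumList C, ‖μ‖ ≤ r) :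
    ∃ D : Matrix (Fin n) (Fin n) ℝ, IsNonnegative D ∧ IsCentrosymmetric D ∧
      D.charpoly = C.charpoly ∧ ∀ i, ∑ j, D i j ≤ s := by
  obtain ⟨y, hy, hCy⟩ := hC.exists_pos_mulVec_le hr hrs h
  let z : Fin n → ℝ := fun i => y i + y i.rev
  have hz : ∀ i, 0 < z i := fun i => add_pos (hy i) (hy _)
  have hzrev : ∀ i, z i.rev = z i := fun i => by simp [z, add_comm]
  have hCz : ∀ i, C.mulVec z i ≤ s * z i := by
    intro i
    have : C.mulVec z i = C.mulVec y i + C.mulVec y i.rev := by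
      rw [← hsymm.mulVec_comp_rev]
      exact congrFun (Matrix.mulVec_add C y fun j => y j.rev) i
    rw [this, mul_add]
    exact add_le_add (hCy i) (hCy _)
  refine ⟨Matrix.diagonal (fun i => (z i)⁻¹) * (C * Matrix.diagonal z), ?_, ?_, ?_, ?_⟩
  · intro i j
    simp only [Matrix.diagonal_mul, Matrix.mul_diagonal]
    exact mul_nonneg (inv_nonneg.2 (hz i).le) (mul_nonneg (hC i j) (hz j).le)
  · intro i j
    simp only [Matrix.diagonal_mul, Matrix.mul_diagonal, hzrev]
    rw [hsymm i j]
  · rw [Matrix.charpoly_mul_comm, Matrix.mul_assoc, Matrix.diagonal_mul_diagonal]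
    simp [(hz _).ne']
  · intro i
    simp only [Matrix.diagonal_mul, Matrix.mul_diagonal, ← Finset.mul_sum]
    rw [inv_mul_le_iff₀ (hz i), mul_comm (z i)]
    exact hCz i

/-- Limit `s → r`: the scaled matrices stay in a compact box, even if the scalings diverge. -/
theorem exists_cospectral_rowSum_le {n : ℕ} {C : Matrix (Fin n) (Fin n) ℝ}
    (hC : IsNonnegative C) (hsymm : IsCentrosymmetric C) {r : ℝ} (hr : 0 ≤ r)
    (h : ∀ μ ∈ spectrumList C, ‖μ‖ ≤ r) :
    ∃ D : Matrix (Fin n) (Fin n) ℝ, IsNonnegative D ∧ IsCentrosymmetric D ∧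
      D.charpoly = C.charpoly ∧ ∀ i, ∑ j, D i j ≤ r := by
  choose D hD hDsymm hDchar hDsum using fun k : ℕ =>
    exists_cospectral_rowSum_le_of_lt hC hsymm hr
      (lt_add_of_pos_right r (Nat.one_div_pos_of_nat (α := ℝ) (n := k))) h
  have hmem : ∀ k, D k ∈ Set.Icc (0 : Fin n → Fin n → ℝ) (fun _ _ => r + 1) := by
    refine fun k => ⟨fun i j => hD k i j, fun i j => ?_⟩
    refine (Finset.single_le_sum (f := fun j => D k i j) (fun j _ => hD k i j)
      (Finset.mem_univ j)).trans ((hDsum k i).trans ?_)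
    have : 1 / ((k : ℝ) + 1) ≤ 1 := by
      rw [div_le_one (by positivity)]
      linarith [(Nat.cast_nonneg k : (0 : ℝ) ≤ k)]
    linarith
  obtain ⟨E, -, φ, hφ, hlim⟩ := 
    (isCompact_Icc (a := (0 : Fin n → Fin n → ℝ))).tendsto_subseq hmem
  have hlim' : ∀ i j, Filter.Tendsto (fun k => D (φ k) i j) Filter.atTop (nhds (E i j)) :=
    fun i j => tendsto_pi_nhds.1 (tendsto_pi_nhds.1 hlim i) j
  refine ⟨E, fun i j => ge_of_tendsto' (hlim' i j) fun k => hD _ i j, fun i j => ?_, ?_,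
    fun i => ?_⟩
  · exact tendsto_nhds_unique (hlim' i j)
      ((hlim' i.rev j.rev).congr fun k => (hDsymm (φ k) i j).symm)
  · refine Polynomial.funext fun t => ?_
    have h1 := ((continuous_eval_charpoly (n := n) t).tendsto E).comp hlim
    refine tendsto_nhds_unique h1 (tendsto_const_nhds.congr fun k => ?_)
    exact congrArg (Polynomial.eval t) (hDchar (φ k)).symm
  · have h1 := tendsto_finsetSum Finset.univ fun j _ => hlim' i j
    have h2 : Filter.Tendsto (fun k => r + 1 / ((φ k : ℝ) + 1)) Filter.atTop (nhds (r + 0)) :=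
      tendsto_const_nhds.add (tendsto_one_div_add_atTop_nhds_zero_nat.comp hφ.tendsto_atTop)
    rw [add_zero] at h2
    exact le_of_tendsto_of_tendsto' h1 h2 fun k => hDsum _ i

/-! ### Row sums equal to the Perron eigenvalue -/

theorem charpoly_eq_of_twoBlockTriangular {m R : Type*} [CommRing R] [IsDomain R] [Infinite R]
    [Fintype m] [DecidableEq m] {C D : Matrix m m R} (p : m → Prop)
    (hC : ∀ i, ¬ p i → ∀ j, p j → C i j = 0) (hD : ∀ i, ¬ p i → ∀ j, p j → D i j = 0)
    (h₁ : ∀ i j, p i → p j → C i j = D i j) (h₂ : ∀ i j, ¬ p i → ¬ p j → C i j = D i j) :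
    C.charpoly = D.charpoly := by
  classical
  have hscalar : ∀ (M : Matrix m m R) (t : R), (∀ i, ¬ p i → ∀ j, p j → M i j = 0) →
      ∀ i, ¬ p i → ∀ j, p j → (Matrix.scalar m t - M) i j = 0 := by
    intro M t hM i hi j hj
    have : i ≠ j := fun hij => hi (hij ▸ hj)
    simp [hM i hi j hj, this]
  refine Polynomial.funext fun t => ?_
  rw [Matrix.eval_charpoly, Matrix.eval_charpoly,
    Matrix.twoBlockTriangular_det _ p (hscalar C t hC),
    Matrix.twoBlockTriangular_det _ p (hscalar D t hD)]
  congr 2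
  · ext ⟨i, hi⟩ ⟨j, hj⟩
    simp [Matrix.toSquareBlockProp, h₁ i j hi hj]
  · ext ⟨i, hi⟩ ⟨j, hj⟩
    simp [Matrix.toSquareBlockProp, h₂ i j hi hj]

/-- If the row sums of `C ≥ 0` are at most `r` and `C x ≥ r x`, then the set of indices at which
`x` is maximal is closed under `C` and its rows have sum `r`. -/
theorem IsNonnegative.rowSum_eq_of_mulVec_ge {n : ℕ} {C : Matrix (Fin n) (Fin n) ℝ}
    (hC : IsNonnegative C) {r : ℝ} (hsum : ∀ i, ∑ j, C i j ≤ r) {x : Fin n → ℝ}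
    (hx : ∀ i, r * x i ≤ C.mulVec x i) {c : ℝ} (hc : 0 < c) (hmax : ∀ i, x i ≤ c)
    {i : Fin n} (hi : x i = c) : (∑ j, C i j = r) ∧ ∀ j, x j ≠ c → C i j = 0 := by
  have hle : C.mulVec x i ≤ ∑ j, C i j * c := by
    rw [Matrix.mulVec_apply_eq_sum]
    exact Finset.sum_le_sum fun j _ => mul_le_mul_of_nonneg_left (hmax j) (hC i j)
  have h1 := hx i
  rw [hi] at h1
  have h2 : ∑ j, C i j = r := by
    refine le_antisymm (hsum i) (le_of_mul_le_mul_right ?_ hc)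
    rw [Finset.sum_mul]
    exact h1.trans hle
  refine ⟨h2, fun j hj => ?_⟩
  have heq : C.mulVec x i = ∑ j, C i j * c := by
    refine le_antisymm hle ?_
    rw [← Finset.sum_mul, h2]
    exact h1
  rw [Matrix.mulVec_apply_eq_sum] at heq
  have h3 := (Finset.sum_eq_sum_iff_of_le
    fun j _ => mul_le_mul_of_nonneg_left (hmax j) (hC i j)).1 heq j (Finset.mem_univ j)
  by_contra h0
  exact hj (mul_left_cancel₀ h0 h3)

/-- A nonnegative centrosymmetric matrix is cospectral to one with all row sums equal to
its Perron eigenvalue. -/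
theorem exists_cospectral_rowSum_eq {n : ℕ} {C : Matrix (Fin n) (Fin n) ℝ}
    (hC : IsNonnegative C) (hsymm : IsCentrosymmetric C) {r : ℝ}
    (hr : IsPerronEigenvalue r (spectrumList C)) :
    ∃ D : Matrix (Fin n) (Fin n) ℝ, IsNonnegative D ∧ IsCentrosymmetric D ∧
      D.charpoly = C.charpoly ∧ ∀ i, ∑ j, D i j = r := by
  have hr0 : 0 ≤ r := (norm_nonneg _).trans (hr.2 _ hr.1)
  obtain ⟨B, hB, hBsymm, hBchar, hBsum⟩ := exists_cospectral_rowSum_le hC hsymm hr0 hr.2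
  obtain ⟨z, hz, hBz⟩ := exists_mulVec_eq_smul_of_mem_spectrumList
    (C := B) (r := r) (spectrumList_eq_of_charpoly_eq hBchar ▸ hr.1)
  have habs : ∀ i, r * |z i| ≤ B.mulVec (fun j => |z j|) i := by
    intro i
    have h1 : r * |z i| = |B.mulVec z i| := by
      rw [hBz, Pi.smul_apply, smul_eq_mul, abs_mul, abs_of_nonneg hr0]
    rw [h1, Matrix.mulVec_apply_eq_sum, Matrix.mulVec_apply_eq_sum]
    refine (Finset.abs_sum_le_sum_abs _ _).trans (Finset.sum_le_sum fun j _ => ?_)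
    rw [abs_mul, abs_of_nonneg (hB i j)]
  let x : Fin n → ℝ := fun i => |z i| + |z i.rev|
  have hxrev : ∀ i, x i.rev = x i := fun i => by simp [x, add_comm]
  have hx : ∀ i, r * x i ≤ B.mulVec x i := by
    intro i
    have : B.mulVec x i = B.mulVec (fun j => |z j|) i + B.mulVec (fun j => |z j|) i.rev := by
      rw [← hBsymm.mulVec_comp_rev]
      exact congrFun (Matrix.mulVec_add B (fun j => |z j|) fun j => |z j.rev|) i
    rw [this, mul_add]
    exact add_le_add (habs i) (habs _)
  obtain ⟨i₀, hi₀⟩ := Function.ne_iff.1 hz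
  have : Nonempty (Fin n) := ⟨i₀⟩
  obtain ⟨p, hp⟩ := Finite.exists_max x
  have hpos : 0 < x p :=
    (add_pos_of_pos_of_nonneg (abs_pos.2 hi₀) (abs_nonneg _)).trans_le (hp i₀)
  have key := fun i (hi : x i = x p) => hB.rowSum_eq_of_mulVec_ge hBsum hx hpos hp hi
  let T : Finset (Fin n) := Finset.univ.filter fun i => x i = x p
  have hTmem : ∀ i, i ∈ T ↔ x i = x p := fun i => by simp [T]
  have hTrev : ∀ i, i.rev ∈ T ↔ i ∈ T := fun i => by simp [hTmem, hxrev]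
  have hTcard : (0 : ℝ) < T.card := by
    exact_mod_cast Finset.card_pos.2 ⟨p, (hTmem p).2 rfl⟩
  -- Rows in `T` vanish off `T`, so the block with rows off `T` and columns in `T` does not affect
  -- the spectrum. It is overwritten to bring each such row sum to `r`.
  let d : Fin n → ℝ := fun i => (r - ∑ k ∈ Tᶜ, B i k) / T.card
  have hd : ∀ i, 0 ≤ d i := fun i => by
    refine div_nonneg (sub_nonneg.2 (le_trans ?_ (hBsum i))) hTcard.le
    exact Finset.sum_le_sum_of_subset_of_nonneg (Finset.subset_univ _) fun j _ _ => hB i j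
  have hdrev : ∀ i, d i.rev = d i := fun i => by
    have : ∑ k ∈ Tᶜ, B i.rev k = ∑ k ∈ Tᶜ, B i k :=
      (Finset.sum_equiv Fin.revPerm (fun k => by simp [hTrev]) fun k _ => by
        simpa using hBsymm i k).symm
    simp only [d, this]
  refine ⟨Matrix.of fun i j => if i ∉ T ∧ j ∈ T then d i else B i j, ?_, ?_, ?_, ?_⟩
  · intro i j
    simp only [Matrix.of_apply]
    split_ifs
    exacts [hd i, hB i j]
  · intro i j
    simp only [Matrix.of_apply, hTrev, hdrev]
    rw [hBsymm i j]
  · rw [← hBchar]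
    refine charpoly_eq_of_twoBlockTriangular (fun i => i ∉ T) ?_ ?_ ?_ ?_
    · intro i hi j hj
      have hi' := not_not.1 hi
      simpa [hi', hj] using (key i ((hTmem i).1 hi')).2 j fun h => hj ((hTmem j).2 h)
    · exact fun i hi j hj => (key i ((hTmem i).1 (not_not.1 hi))).2 j fun h => hj ((hTmem j).2 h)
    · intro i j hi hj
      simp [hi, hj]
    · intro i j hi hj
      simp [not_not.1 hi]
  · intro i
    by_cases hi : i ∈ T
    · simpa [hi] using (key i ((hTmem i).1 hi)).1
    · rw [← Finset.sum_add_sum_compl T]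
      have h1 : ∑ j ∈ T, (Matrix.of fun i j => if i ∉ T ∧ j ∈ T then d i else B i j) i j
          = ∑ j ∈ T, d i := Finset.sum_congr rfl fun j hj => by simp [hi, hj]
      have h2 : ∑ j ∈ Tᶜ, (Matrix.of fun i j => if i ∉ T ∧ j ∈ T then d i else B i j) i j
          = ∑ j ∈ Tᶜ, B i j :=
        Finset.sum_congr rfl fun j hj => by simp [Finset.mem_compl.1 hj]
      rw [h1, h2, Finset.sum_const, nsmul_eq_mul, mul_div_cancel₀ _ hTcard.ne']
      ring

/-! ### The rank-two perturbation -/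

/-- A second real eigenvalue `b` of a centrosymmetric matrix with constant row sums `a` comes with
a nonconstant vector `v`, an eigenvector of the reversal of indices, with `C v = b v + c 1`. -/
theorem exists_nonconstant_mulVec_eq {n : ℕ} {C : Matrix (Fin n) (Fin n) ℝ}
    (hsymm : IsCentrosymmetric C) {a b : ℝ} (hsum : ∀ i, ∑ j, C i j = a) {L : Multiset ℂ}
    (hL : spectrumList C = (a : ℂ) ::ₘ (b : ℂ) ::ₘ L) :
    ∃ (v : Fin n → ℝ) (c ε : ℝ), (∀ i, v i.rev = ε * v i) ∧
      (∃ i j, v i ≠ v j) ∧ ∀ i, C.mulVec v i = b * v i + c := by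
  have hn : (n : ℝ) ≠ 0 := by
    rintro h0
    obtain rfl : n = 0 := by exact_mod_cast h0
    simp [spectrumList] at hL
  -- Adding `w` to every entry moves the eigenvalue `a` of `1` to `b + 1`, so no constant vector is
  -- an eigenvector for `b`, even when `a = b`.
  let w : ℝ := (b + 1 - a) / n
  have hw : (n : ℝ) * w = b + 1 - a := mul_div_cancel₀ _ hn
  let B : Matrix (Fin n) (Fin n) ℝ := Matrix.of fun i j => C i j + w
  have hBsymm : IsCentrosymmetric B := fun i j => by
    simp only [B, Matrix.of_apply]; rw [hsymm i j]
  have hBmul : ∀ v i, B.mulVec v i = C.mulVec v i + w * ∑ j, v j := fun v i => by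
    simp [B, Matrix.mulVec, dotProduct, add_mul, Finset.sum_add_distrib, Finset.mul_sum]
  have hbr := spectrumList_add_mul_of_mul_eq_mul (C := C) (X := Matrix.of fun _ (_ : Fin 1) => 1)
    (Ω := Matrix.of fun _ _ => a) (by ext i j; simp [Matrix.mul_apply, hsum])
    (Matrix.of fun _ _ => w)
  have hB : C + (Matrix.of fun _ _ => 1 : Matrix (Fin n) (Fin 1) ℝ) *
      (Matrix.of fun _ _ => w : Matrix (Fin 1) (Fin n) ℝ) = B := by
    ext i j; simp [B, Matrix.mul_apply]
  have hupper : ∀ M : Matrix (Fin 1) (Fin 1) ℝ, M.IsUpperTriangular := fun M i j hij =>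
    absurd hij (by simp [Subsingleton.elim i j])
  rw [hB, spectrumList_of_isUpperTriangular (hupper _),
    spectrumList_of_isUpperTriangular (hupper _), hL] at hbr
  have hbr' : (a : ℂ) ::ₘ spectrumList B =
      (a : ℂ) ::ₘ (b : ℂ) ::ₘ (L + {((a + n * w : ℝ) : ℂ)}) := by
    rw [← Multiset.singleton_add, add_comm]
    simpa [Matrix.mul_apply] using hbr
  have hmem : (b : ℂ) ∈ spectrumList B := by
    rw [(Multiset.cons_inj_right _).1 hbr']
    exact Multiset.mem_cons_self _ _
  obtain ⟨z, hz, hBz⟩ := exists_mulVec_eq_smul_of_mem_spectrumList hmem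
  obtain ⟨v, ε, hv, hvrev, hBv⟩ : ∃ (v : Fin n → ℝ) (ε : ℝ), v ≠ 0 ∧
      (∀ i, v i.rev = ε * v i) ∧ ∀ i, B.mulVec v i = b * v i := by
    have hBz' : ∀ i, B.mulVec z i = b * z i := fun i => congrFun hBz i
    -- Either `z` is odd under reversal, or its even part is a nonzero eigenvector.
    by_cases h0 : ∀ i, z i + z i.rev = 0
    · refine ⟨z, -1, hz, fun i => by linarith [h0 i], hBz'⟩
    · push Not at h0
      obtain ⟨i, hi⟩ := h0
      refine ⟨fun i => z i + z i.rev, 1, fun h => hi (congrFun h i),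
        fun i => by simp [add_comm], fun i => ?_⟩
      have : B.mulVec (fun i => z i + z i.rev) i = B.mulVec z i + B.mulVec z i.rev := by
        rw [← hBsymm.mulVec_comp_rev]
        exact congrFun (Matrix.mulVec_add B z fun j => z j.rev) i
      rw [this, hBz', hBz', mul_add]
  refine ⟨v, -(w * ∑ j, v j), ε, hvrev, ?_, fun i => ?_⟩
  · by_contra! hconst
    obtain ⟨i, hi⟩ := Function.ne_iff.1 hv
    have h1 := hBv i
    rw [hBmul] at h1
    have h2 : C.mulVec v i = a * v i := by
      simp only [Matrix.mulVec, dotProduct]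
      rw [← hsum i, Finset.sum_mul]
      exact Finset.sum_congr rfl fun j _ => by rw [hconst j i]
    have h3 : ∑ j, v j = n * v i := by
      rw [Finset.sum_congr rfl fun j _ => hconst j i]
      simp
    rw [h2, h3] at h1
    have h4 : v i = 0 := by linear_combination h1 - v i * hw
    exact hi h4
  · have := hBv i
    rw [hBmul] at this
    linarith

/-- A nonnegative perturbation `1 a + v b` of rank at most two, supported on the columns
`k` and `l`. -/
theorem exists_rankTwo_nonneg {n : ℕ} {v : Fin n → ℝ} {m M s : ℝ} (hm : ∀ i, m ≤ v i)
    (hM : ∀ i, v i ≤ M) (hs : 0 ≤ s) (k l : Fin n) :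
    ∃ a b : Fin n → ℝ, (∀ i j, 0 ≤ a j + b j * v i) ∧ ∑ j, a j = s * (M - m) ∧
      ∑ j, b j = 0 ∧ ∑ j, b j * v j = s * (v k - v l) := by
  have hsingle : ∀ i j, 0 ≤ (Pi.single i 1 : Fin n → ℝ) j := fun i j => by
    rw [Pi.single_apply]; split_ifs <;> norm_num
  -- Column `k` becomes `s (v - m)` and column `l` becomes `s (M - v)`; they add up if `k = l`.
  refine ⟨fun j => s * (M * (Pi.single l 1 : Fin n → ℝ) j - m * (Pi.single k 1 : Fin n → ℝ) j),
    fun j => s * ((Pi.single k 1 : Fin n → ℝ) j - (Pi.single l 1 : Fin n → ℝ) j), ?_, ?_, ?_, ?_⟩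
  · intro i j
    linarith [mul_nonneg (mul_nonneg hs (sub_nonneg.2 (hm i))) (hsingle k j),
      mul_nonneg (mul_nonneg hs (sub_nonneg.2 (hM i))) (hsingle l j)]
  · simp [← Finset.mul_sum, Finset.sum_sub_distrib]
  · simp [← Finset.mul_sum, Finset.sum_sub_distrib]
  · simp [mul_assoc, sub_mul, ← Finset.mul_sum, Finset.sum_sub_distrib, Pi.single_apply]

theorem IsCentrosymmetric.mem_CR_of_rankTwo {n : ℕ} {C : Matrix (Fin n) (Fin n) ℝ}
    (hC : IsNonnegative C) (hsymm : IsCentrosymmetric C) {lam₁ lam₂ : ℝ}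
    (hsum : ∀ i, ∑ j, C i j = lam₁) {L : Multiset ℂ}
    (hL : spectrumList C = (lam₁ : ℂ) ::ₘ (lam₂ : ℂ) ::ₘ L) {v : Fin n → ℝ} {c ε : ℝ}
    (hrev : ∀ i, v i.rev = ε * v i)
    (hCv : ∀ i, C.mulVec v i = lam₂ * v i + c) {a b : Fin n → ℝ}
    (hab : ∀ i j, 0 ≤ a j + b j * v i) {t u : ℝ} (ha : ∑ j, a j = t) (hb : ∑ j, b j = 0)
    (hbv : ∑ j, b j * v j = u) :
    ((lam₁ + t : ℝ) : ℂ) ::ₘ ((lam₂ + u : ℝ) : ℂ) ::ₘ L ∈ CR n := by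
  have hsumrev : ∀ f : Fin n → ℝ, ∑ j : Fin n, f j.rev = ∑ j, f j := fun f => Equiv.sum_comp Fin.revPerm f
  let a' : Fin n → ℝ := fun j => (a j + a j.rev) / 2
  -- The factor `ε` compensates for reversing `v`, so the new entry `(i, j)` is the mean of the old
  -- ones at `(i, j)` and its reversal.
  let b' : Fin n → ℝ := fun j => (b j + ε * b j.rev) / 2
  have ha' : ∑ j, a' j = t := by
    simp only [a', ← Finset.sum_div, Finset.sum_add_distrib, hsumrev, ha]
    ring
  have hb' : ∑ j, b' j = 0 := by
    simp only [b', ← Finset.sum_div, Finset.sum_add_distrib, ← Finset.mul_sum, hsumrev, hb]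
    ring
  have hbv' : ∑ j, b' j * v j = u := by
    have : ∀ j, b' j * v j = (b j * v j + b j.rev * v j.rev) / 2 := fun j => by
      simp only [b', hrev]; ring
    simp only [this, ← Finset.sum_div, Finset.sum_add_distrib,
      hsumrev fun j => b j * v j, hbv]
    ring
  have hentry : ∀ i j, a' j + v i * b' j =
      ((a j + b j * v i) + (a j.rev + b j.rev * v i.rev)) / 2 := fun i j => by
    simp only [a', b', hrev]; ring
  let X : Matrix (Fin n) (Fin 2) ℝ := Matrix.of fun i => ![1, v i]
  let W : Matrix (Fin 2) (Fin n) ℝ := Matrix.of ![a', b']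
  let Ω : Matrix (Fin 2) (Fin 2) ℝ := !![lam₁, c; 0, lam₂]
  have hXW : ∀ i j, (X * W) i j = a' j + v i * b' j := fun i j => by
    simp [X, W, Matrix.mul_apply, Fin.sum_univ_two]
  have hCX : C * X = X * Ω := by
    ext i j
    have := hCv i
    simp only [Matrix.mulVec, dotProduct] at this
    fin_cases j
    · simp [X, Ω, Matrix.mul_apply, Fin.sum_univ_two, hsum]
    · simp [X, Ω, Matrix.mul_apply, Fin.sum_univ_two, this]
      ring
  have hWX : Ω + W * X = !![lam₁ + t, c + ∑ j, a' j * v j; 0, lam₂ + u] := by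
    ext i j
    fin_cases i <;> fin_cases j <;>
      simp [X, W, Ω, Matrix.vecMul, dotProduct, ha', hb', hbv']
  have hspec : ∀ x y z : ℝ, spectrumList !![x, y; 0, z] = (x : ℂ) ::ₘ (z : ℂ) ::ₘ 0 := by
    intro x y z
    rw [spectrumList_of_isUpperTriangular]
    · simp [Fin.univ_val_map]
      rfl
    · intro i j hij
      fin_cases i <;> fin_cases j <;> simp at hij ⊢
  refine ⟨C + X * W, fun i j => ?_, fun i j => ?_, ?_⟩
  · rw [Matrix.add_apply, hXW, hentry]
    have := hab i j
    have := hab i.rev j.rev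
    have := hC i j
    positivity
  · rw [Matrix.add_apply, Matrix.add_apply, hXW, hXW, hentry, hentry, ← hsymm i j,
      Fin.rev_rev, Fin.rev_rev]
    ring
  · have hbr := spectrumList_add_mul_of_mul_eq_mul hCX W
    rw [hWX, hspec, hspec, hL] at hbr
    refine add_right_cancel (hbr.trans ?_)
    simp only [← Multiset.singleton_add]
    abel

theorem IsPerronEigenvalue.add {lam₁ lam₂ t u : ℝ} {L : Multiset ℂ}
    (h : IsPerronEigenvalue lam₁ ((lam₁ : ℂ) ::ₘ (lam₂ : ℂ) ::ₘ L)) (hu : |u| ≤ t) :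
    IsPerronEigenvalue (lam₁ + t) (((lam₁ + t : ℝ) : ℂ) ::ₘ ((lam₂ + u : ℝ) : ℂ) ::ₘ L) := by
  have ht : 0 ≤ t := (abs_nonneg u).trans hu
  have h0 : 0 ≤ lam₁ := (norm_nonneg _).trans (h.2 _ h.1)
  have h2 : |lam₂| ≤ lam₁ := by simpa using h.2 (lam₂ : ℂ) (by simp)
  refine ⟨Multiset.mem_cons_self _ _, fun μ hμ => ?_⟩
  rcases Multiset.mem_cons.1 hμ with rfl | hμ
  · rw [Complex.norm_real, Real.norm_of_nonneg (add_nonneg h0 ht)]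
  rcases Multiset.mem_cons.1 hμ with rfl | hμ
  · rw [Complex.norm_real, Real.norm_eq_abs]
    exact (abs_add_le _ _).trans (add_le_add h2 hu)
  · linarith [h.2 μ (by simp [hμ])]

theorem theorem4p2 (n : ℕ) (lam₁ lam₂ : ℝ) (L : Multiset ℂ)
    (hL : (lam₁ : ℂ) ::ₘ (lam₂ : ℂ) ::ₘ L ∈ CR n)
    (hPerron : IsPerronEigenvalue lam₁ ((lam₁ : ℂ) ::ₘ (lam₂ : ℂ) ::ₘ L))
    (t : ℝ) (ht : 0 ≤ t) :
    (((lam₁ + t : ℝ) : ℂ) ::ₘ ((lam₂ + t : ℝ) : ℂ) ::ₘ L ∈ CR n ∧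
      IsPerronEigenvalue (lam₁ + t)
        (((lam₁ + t : ℝ) : ℂ) ::ₘ ((lam₂ + t : ℝ) : ℂ) ::ₘ L)) ∧
    (((lam₁ + t : ℝ) : ℂ) ::ₘ ((lam₂ - t : ℝ) : ℂ) ::ₘ L ∈ CR n ∧
      IsPerronEigenvalue (lam₁ + t)
        (((lam₁ + t : ℝ) : ℂ) ::ₘ ((lam₂ - t : ℝ) : ℂ) ::ₘ L)) := by
  obtain ⟨C, hC, hsymm, hspec⟩ := hL
  obtain ⟨D, hD, hDsymm, hDchar, hDsum⟩ :=
    exists_cospectral_rowSum_eq hC hsymm (r := lam₁) (hspec.symm ▸ hPerron)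
  have hDspec := (spectrumList_eq_of_charpoly_eq hDchar).trans hspec
  obtain ⟨v, c, ε, hrev, ⟨i, j, hij⟩, hDv⟩ := exists_nonconstant_mulVec_eq hDsymm hDsum hDspec
  have : Nonempty (Fin n) := ⟨i⟩
  obtain ⟨p, hp⟩ := Finite.exists_max v
  obtain ⟨q, hq⟩ := Finite.exists_min v
  have hqp : 0 < v p - v q := by
    rcases lt_or_gt_of_ne hij with h | h
    · linarith [hp j, hq i]
    · linarith [hp i, hq j]
  have hs : 0 ≤ t / (v p - v q) := div_nonneg ht hqp.le
  have hst : t / (v p - v q) * (v p - v q) = t := div_mul_cancel₀ _ hqp.ne'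
  obtain ⟨a, b, hab, ha, hb, hbv⟩ := exists_rankTwo_nonneg hq hp hs p q
  obtain ⟨a', b', hab', ha', hb', hbv'⟩ := exists_rankTwo_nonneg hq hp hs q p
  rw [hst] at ha hbv ha'
  rw [← neg_sub (v p), mul_neg, hst] at hbv'
  have habs : |t| ≤ t := (abs_of_nonneg ht).le
  rw [sub_eq_add_neg lam₂ t]
  exact ⟨⟨hDsymm.mem_CR_of_rankTwo hD hDsum hDspec hrev hDv hab ha hb hbv, hPerron.add habs⟩,
    hDsymm.mem_CR_of_rankTwo hD hDsum hDspec hrev hDv hab' ha' hb' hbv',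
    hPerron.add ((abs_neg t).trans_le habs)⟩
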